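/- Let $S$ be a semigroup. A finite coloring of $S$ is a map from $S$ to a finite set of colors, and a $2$-coloring is a map from $S$ to a set of two colors (colors need not all be used). Given a coloring, a subset $A\subseteq S$ is almost-monochromatic if all but finitely many members of $A$ have the same color. A semigroup $T$ is finitely synchronizing if there is a finite set $F\subseteq T$ such that $ab\in\{a,b\}\cup F$ for all $a,b\in T$. Let $\bigoplus_n\mathbb{Z}_2$ denote the group of all finitely supported elements of $\mathbb{Z}_2^{\mathbb{N}}$, with pointwise addition. The following are equivalent: 1. For each finite coloring of $S$, there is an infinite almost-monochromatic subsemigroup of $S$. 2. For each $2$-coloring of $S$, there is an infinite almost-monochromatic subsemigroup of $S$. 3. At least one of the following assertions holds: (a) $S$ has an infinite, finitely synchronizing subsemigroup; (b) $S$ has a subsemigroup isomorphic to $\bigoplus_n\mathbb{Z}_2$. -/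

import Mathlib

/-- A set `A` is almost-monochromatic for the coloring `c` if all but finitely many members of
`A` have the same color. -/
def AlmostMonochromatic {S κ : Type*} (c : S → κ) (A : Set S) : Prop :=
  ∃ k : κ, {a ∈ A | c a ≠ k}.Finite

/-- A semigroup is finitely synchronizing if there is a finite `F` such that `a * b ∈ {a, b} ∪ F`
for all `a` and `b`. -/
def FinitelySynchronizing (T : Type*) [Semigroup T] : Prop :=
  ∃ F : Set T, F.Finite ∧ ∀ a b : T, a * b ∈ ({a, b} : Set T) ∪ F

/-- Every coloring of `S` with `n` colors (not all of which need be used) admits an infinite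
almost-monochromatic subsemigroup. -/
def HasAlmostMonoSubsemigroups (S : Type*) [Semigroup S] (n : ℕ) : Prop :=
  ∀ c : S → Fin n, ∃ T : Subsemigroup S,
    (T : Set S).Infinite ∧ AlmostMonochromatic c (T : Set S)

/-- `S` contains (an isomorphic copy of) the direct sum of countably infinitely many copies of
`ZMod 2`, the group of finitely supported sequences in `ZMod 2`, as a subsemigroup. -/
def ContainsDirectSumZMod2 (S : Type*) [Semigroup S] : Prop :=
  ∃ f : Multiplicative (ℕ →₀ ZMod 2) →ₙ* S, Function.Injective f

/-! Assertion 3 gives 1 by Ramsey theory. In case (a), an infinite colour class of the subsemigroup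
together with `F` is closed under multiplication. In case (b), Hindman's theorem gives vectors whose
nonempty finite sums are nonzero and of one colour; they span a copy of the group.

For 2 implies 3, one colouring suffices. The map `invOrSq` has no periodic points of period above
two, so two colours can be assigned such that every moved point changes colour
(`exists_bool_coloring`). A subsemigroup is closed under `invOrSq`, so an almost-monochromatic one
is tame: almost every `x` has `x ^ 3 = x`, or has its square in a fixed finite set
(`exists_coloring_isTame`).

Let `S` be infinite and tame, without synchronizing structure. If every `u S u` were finite, so
would be all `u S` and `S u`, and limits along ultrafilters would produce such structure
(`hasSync_of_finite_translations`). Hence some corner `e S e` with `e` idempotent is infinite.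
Infinitely many units of the corner would form a tame group, almost all of whose elements are
involutions, and this yields case (b). Otherwise the non-units form an infinite tame subsemigroup,
which contains a smaller idempotent with an infinite corner. Iterating gives a strictly decreasing
chain of idempotents, which is synchronizing (`IsTame.hasSync_or_containsDirectSumZMod2`). -/

/-! ### Positive powers in a semigroup. -/

section Powers

variable {S : Type*} [Semigroup S]

/-- The positive powers of an element of a semigroup: `posPow x n` is `x` multiplied by itself
`n + 1` times. -/
def posPow (x : S) : ℕ → S
  | 0 => x
  | n + 1 => posPow x n * x

theorem posPow_mul_posPow (x : S) (m n : ℕ) :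
    posPow x m * posPow x n = posPow x (m + n + 1) := by
  induction n with
  | zero => rfl
  | succ n ih => rw [posPow, ← mul_assoc, ih]; rfl

theorem posPow_posPow (x : S) (m n : ℕ) :
    posPow (posPow x m) n = posPow x (m * n + m + n) := by
  induction n with
  | zero => simp [posPow]
  | succ n ih => rw [posPow, ih, posPow_mul_posPow]; congr 1; ring

theorem mul_posPow (x : S) (n : ℕ) : x * posPow x n = posPow x (n + 1) := by
  have := posPow_mul_posPow x 0 n
  rwa [zero_add] at this

theorem posPow_add_mul {x : S} {a d : ℕ} (h : posPow x (a + d) = posPow x a) (k m : ℕ) :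
    posPow x (a + m + k * d) = posPow x (a + m) := by
  have h1 : ∀ m, posPow x (a + m + d) = posPow x (a + m) := by
    intro m
    induction m with
    | zero => exact h
    | succ m ih =>
      rw [show a + (m + 1) + d = (a + m + d) + 1 by ring, posPow, ih]; rfl
  induction k with
  | zero => simp
  | succ k ih =>
    rw [show a + m + (k + 1) * d = a + (m + k * d) + d by ring, h1, ← add_assoc, ih]

theorem posPow_mem (T : Subsemigroup S) {x : S} (hx : x ∈ T) (n : ℕ) : posPow x n ∈ T := by
  induction n with
  | zero => exact hx
  | succ n ih => exact T.mul_mem ih hx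

theorem map_posPow {T : Type*} [Semigroup T] (f : T →ₙ* S) (x : T) (n : ℕ) :
    f (posPow x n) = posPow (f x) n := by
  induction n with
  | zero => rfl
  | succ n ih => simp [posPow, ih]

end Powers

/-! ### Inverses in subgroups and the map to be coloured. -/

section GroupInverse

variable {S : Type*} [Semigroup S]

/-- `y` is the inverse of `x` in some subgroup of the semigroup. -/
def IsGroupInverse (x y : S) : Prop :=
  x * y * x = x ∧ y * x * y = y ∧ x * y = y * x

theorem IsGroupInverse.symm {x y : S} (h : IsGroupInverse x y) : IsGroupInverse y x :=
  ⟨h.2.1, h.1, h.2.2.symm⟩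

theorem IsGroupInverse.unique {x y z : S} (hy : IsGroupInverse x y) (hz : IsGroupInverse x z) :
    y = z := by
  obtain ⟨h1, h2, h3⟩ := hy
  obtain ⟨k1, k2, k3⟩ := hz
  have e : y * x = z * x := by
    calc y * x = y * (x * z * x) := by rw [k1]
      _ = (y * x) * (z * x) := by simp only [mul_assoc]
      _ = (x * y) * (x * z) := by rw [h3, k3]
      _ = (x * y * x) * z := by simp only [mul_assoc]
      _ = z * x := by rw [h1, k3]
  calc y = y * x * y := h2.symm
    _ = z * (x * y) := by rw [e, mul_assoc]
    _ = z * (z * x) := by rw [h3, e]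
    _ = z * x * z := by rw [mul_assoc z x z, k3]
    _ = z := k2

/-- `x` is a torsion element of some subgroup of the semigroup. -/
def IsTorsionUnit (x : S) : Prop := ∃ n, posPow x (n + 1) = x

theorem IsTorsionUnit.exists_inverse {x : S} (h : IsTorsionUnit x) :
    ∃ n, IsGroupInverse x (posPow x n) := by
  obtain ⟨n, hn⟩ := h
  have hp : ∀ m, posPow x (m + 2 * (n + 1)) = posPow x m := fun m => by
    have := posPow_add_mul (x := x) (a := 0) (d := n + 1) (by rw [zero_add, hn]; rfl) 2 m
    simpa using this
  -- The inverse is the `n`-th power, of index `n - 1`; adding one period `n + 1` avoids subtraction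
  -- when `n = 0`.
  refine ⟨2 * n, ?_, ?_, ?_⟩
  · rw [mul_posPow]
    change posPow x (2 * n + 1 + 1) = x
    have := hp 0
    rwa [show 0 + 2 * (n + 1) = 2 * n + 1 + 1 by ring] at this
  · change posPow x (2 * n + 1) * _ = _
    rw [posPow_mul_posPow, show 2 * n + 1 + 2 * n + 1 = 2 * n + 2 * (n + 1) by ring, hp]
  · rw [mul_posPow]; rfl

theorem IsGroupInverse.isTorsionUnit {x : S} {n : ℕ} (h : IsGroupInverse x (posPow x n)) :
    IsTorsionUnit x := by
  refine ⟨n + 1, ?_⟩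
  have := h.1
  rwa [mul_posPow] at this

theorem IsGroupInverse.isTorsionUnit_right {x : S} {n : ℕ}
    (h : IsGroupInverse x (posPow x n)) : IsTorsionUnit (posPow x n) := by
  have h1 : posPow x (0 + (n + 2)) = posPow x 0 := by
    have := h.1
    rw [mul_posPow] at this
    rw [zero_add]; exact this
  have h2 := posPow_add_mul h1 n 0
  have h3 : posPow (posPow x n) n = x := by
    rw [posPow_posPow, show n * n + n + n = 0 + 0 + n * (n + 2) by ring, h2]; rfl
  refine IsGroupInverse.isTorsionUnit (n := n) ?_
  rw [h3]; exact h.symm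

open Classical in
/-- Torsion elements of subgroups are sent to their inverse, all others to their square. -/
noncomputable def invOrSq (x : S) : S :=
  if h : IsTorsionUnit x then posPow x h.exists_inverse.choose else x * x

theorem invOrSq_of_isTorsionUnit {x : S} (h : IsTorsionUnit x) :
    (∃ n, invOrSq x = posPow x n) ∧ IsGroupInverse x (invOrSq x) := by
  rw [invOrSq, dif_pos h]
  exact ⟨⟨_, rfl⟩, h.exists_inverse.choose_spec⟩

theorem invOrSq_of_not_isTorsionUnit {x : S} (h : ¬ IsTorsionUnit x) : invOrSq x = x * x := by
  rw [invOrSq, dif_neg h]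

theorem IsTorsionUnit.invOrSq {x : S} (h : IsTorsionUnit x) : IsTorsionUnit (invOrSq x) := by
  obtain ⟨⟨n, hn⟩, h2⟩ := invOrSq_of_isTorsionUnit h
  rw [hn] at h2 ⊢
  exact h2.isTorsionUnit_right

theorem IsTorsionUnit.invOrSq_invOrSq {x : S} (h : IsTorsionUnit x) :
    _root_.invOrSq (_root_.invOrSq x) = x :=
  (invOrSq_of_isTorsionUnit h.invOrSq).2.unique (invOrSq_of_isTorsionUnit h).2.symm

theorem invOrSq_mem (T : Subsemigroup S) {x : S} (hx : x ∈ T) : invOrSq x ∈ T := by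
  by_cases h : IsTorsionUnit x
  · obtain ⟨⟨n, hn⟩, -⟩ := invOrSq_of_isTorsionUnit h
    rw [hn]; exact posPow_mem T hx n
  · rw [invOrSq_of_not_isTorsionUnit h]; exact T.mul_mem hx hx

theorem mul_mul_self_of_invOrSq_eq {x : S} (h : invOrSq x = x) : x * x * x = x := by
  by_cases hx : IsTorsionUnit x
  · have := (invOrSq_of_isTorsionUnit hx).2.1
    rwa [h] at this
  · rw [invOrSq_of_not_isTorsionUnit hx] at h
    rw [h, h]

theorem exists_iterate_invOrSq (x : S) (n : ℕ) :
    IsTorsionUnit (invOrSq^[n] x) ∨ invOrSq^[n] x = posPow x (2 ^ n - 1) := by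
  induction n with
  | zero => right; rfl
  | succ n ih =>
    rw [Function.iterate_succ_apply']
    by_cases h : IsTorsionUnit (invOrSq^[n] x)
    · exact Or.inl h.invOrSq
    · right
      rw [invOrSq_of_not_isTorsionUnit h, ih.resolve_left h, posPow_mul_posPow]
      congr 1
      have : 0 < 2 ^ n := by positivity
      rw [pow_succ]; omega

/-- Off the torsion units the iteration is repeated squaring, and a return to `x` would itself make
`x` a torsion unit. On torsion units the map is inversion. -/
theorem invOrSq_periodic {x : S} {n : ℕ} (h : invOrSq^[n + 1] x = x) :
    invOrSq (invOrSq x) = x := by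
  suffices hx : IsTorsionUnit x from hx.invOrSq_invOrSq
  rcases exists_iterate_invOrSq x (n + 1) with h1 | h1
  · rwa [h] at h1
  · rw [h] at h1
    have : 0 < 2 ^ n := by positivity
    refine ⟨2 ^ n * 2 - 2, ?_⟩
    rw [pow_succ] at h1
    rw [show 2 ^ n * 2 - 2 + 1 = 2 ^ n * 2 - 1 by omega]
    exact h1.symm

end GroupInverse

/-! ### Two-colouring a functional graph. -/

section FunctionalGraph

variable {α : Type*}

/-- An orbit that collides with itself without meeting a fixed point ends in a cycle of length
exactly two. -/
theorem even_add_of_iterate_eq {f : α → α} (hf : ∀ x n, f^[n + 1] x = x → f (f x) = x) {x : α}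
    (hx : ∀ k, f (f^[k] x) ≠ f^[k] x) {m n : ℕ} (h : f^[m] x = f^[n] x) : Even (m + n) := by
  wlog hmn : m ≤ n generalizing m n
  · rw [add_comm]; exact this h.symm (by omega)
  obtain ⟨d, rfl⟩ := Nat.exists_eq_add_of_le hmn
  rw [add_comm m d, Function.iterate_add_apply] at h
  have hd : Even d := by
    rcases d with _ | d
    · exact ⟨0, rfl⟩
    have h2 := hf _ _ h.symm
    by_contra ho
    rw [Nat.not_even_iff_odd] at ho
    obtain ⟨k, hk⟩ := ho
    have h3 : ∀ k, f^[2 * k] (f^[m] x) = f^[m] x := fun k => by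
      induction k with
      | zero => rfl
      | succ k ih =>
        rw [show 2 * (k + 1) = 2 * k + 1 + 1 by ring, Function.iterate_succ_apply',
          Function.iterate_succ_apply', ih, h2]
    rw [hk] at h
    have h4 := Function.iterate_succ_apply' f (2 * k) (f^[m] x)
    rw [h3] at h4
    exact hx m (h4.symm.trans h.symm)
  rw [← add_assoc]; exact (Even.add ⟨m, rfl⟩ hd)

/-- If all periodic points of `f` have period at most two, then the points can be coloured with
two colours so that `f` changes the colour of every point it moves. -/
theorem exists_bool_coloring (f : α → α) (hf : ∀ x n, f^[n + 1] x = x → f (f x) = x) :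
    ∃ c : α → Bool, ∀ x, f x ≠ x → c (f x) ≠ c x := by
  classical
  let s : Setoid α :=
    { r := fun x y => ∃ m n, f^[m] x = f^[n] y
      iseqv :=
        { refl := fun x => ⟨0, 0, rfl⟩
          symm := fun ⟨m, n, h⟩ => ⟨n, m, h.symm⟩
          trans := fun {x y z} ⟨m, n, h⟩ ⟨k, l, h'⟩ => ⟨k + m, n + l, by
            rw [Function.iterate_add_apply, h, ← Function.iterate_add_apply, add_comm,
              Function.iterate_add_apply, h', ← Function.iterate_add_apply]⟩ } }
  let rep : α → α := fun x => (Quotient.mk s x).out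
  have hrep : ∀ x, ∃ m n, f^[m] x = f^[n] (rep x) := fun x =>
    s.symm (Quotient.mk_out (s := s) x)
  have hrepf : ∀ x, rep (f x) = rep x := fun x => by
    have : Quotient.mk s (f x) = Quotient.mk s x := Quotient.sound ⟨0, 1, rfl⟩
    simp only [rep, this]
  let fin : α → Prop := fun x => ∃ k, f (f^[k] x) = f^[k] x
  have hfin : ∀ x, fin (f x) ↔ fin x := fun x => by
    constructor
    · rintro ⟨k, hk⟩
      exact ⟨k + 1, hk⟩
    · rintro ⟨k, hk⟩
      refine ⟨k, ?_⟩
      rw [← Function.iterate_succ_apply, Function.iterate_succ_apply', hk, hk]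
  -- If the orbit reaches a fixed point, colour by the parity of the number of steps to it.
  -- Otherwise colour by the parity of the distance to a representative of the component, which is
  -- well defined because cycles there are even.
  refine ⟨fun x => if h : fin x then decide (Even (Nat.find h))
    else decide (∃ m n, f^[m] x = f^[n] (rep x) ∧ Even (m + n)), fun x hx => ?_⟩
  by_cases h : fin x
  · have h' := (hfin x).2 h
    simp only [dif_pos h, dif_pos h']
    have : Nat.find h = Nat.find h' + 1 := Nat.find_comp_succ h h' (by simpa using hx)
    rw [this, Ne, decide_eq_decide, Nat.even_add_one]
    tauto
  · have h' := mt (hfin x).1 h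
    simp only [dif_neg h, dif_neg h', hrepf]
    have hx' : ∀ k, f (f^[k] x) ≠ f^[k] x := fun k hk => h ⟨k, hk⟩
    have key : ∀ m n m' n', f^[m] x = f^[n] (rep x) → f^[m'] x = f^[n'] (rep x) →
        Even (m + n) → Even (m' + n') := by
      intro m n m' n' h1 h2 he
      have h3 : f^[n' + m] x = f^[n + m'] x := by
        rw [Function.iterate_add_apply, h1, ← Function.iterate_add_apply, add_comm,
          Function.iterate_add_apply, ← h2, ← Function.iterate_add_apply]
      have := even_add_of_iterate_eq hf hx' h3
      rw [Nat.even_iff] at *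
      omega
    obtain ⟨m, n, hmn⟩ := hrep (f x)
    rw [hrepf, ← Function.iterate_succ_apply] at hmn
    rw [Ne, decide_eq_decide]
    intro hiff
    by_cases he : Even (m + n)
    · obtain ⟨m', n', h1, h2⟩ := hiff.1 ⟨m, n, hmn, he⟩
      have := key _ _ _ _ h1 hmn h2
      rw [Nat.even_iff] at *
      omega
    · obtain ⟨m', n', h1, h2⟩ := hiff.2 ⟨m + 1, n, hmn, by rw [Nat.even_iff] at *; omega⟩
      have := key (m + 1) n (m' + 1) n' hmn h1 (by rw [Nat.even_iff] at *; omega)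
      rw [Nat.even_iff] at *
      omega

end FunctionalGraph

/-! ### Synchronizing sets from one-sided and two-sided translations. -/

section Synchronizing

/-- `S` contains an infinite set `Y` and a finite set `F` such that every product of two elements
of `Y ∪ F` is one of the factors or an element of `F`. -/
def HasSync (S : Type*) [Semigroup S] : Prop :=
  ∃ Y F : Set S, Y.Infinite ∧ F.Finite ∧
    ∀ a ∈ Y ∪ F, ∀ b ∈ Y ∪ F, a * b = a ∨ a * b = b ∨ a * b ∈ F

variable {S : Type*} [Semigroup S]

theorem HasSync.exists_subsemigroup (h : HasSync S) :
    ∃ T : Subsemigroup S, (T : Set S).Infinite ∧ FinitelySynchronizing T := by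
  obtain ⟨Y, F, hY, hF, h⟩ := h
  refine ⟨⟨Y ∪ F, fun {a b} ha hb => ?_⟩, hY.mono Set.subset_union_left,
    Subtype.val ⁻¹' F, hF.preimage Subtype.val_injective.injOn, fun a b => ?_⟩
  · rcases h a ha b hb with h | h | h
    · rwa [h]
    · rwa [h]
    · exact Or.inr h
  · rcases h a a.2 b b.2 with h | h | h
    · exact Or.inl (Or.inl (Subtype.ext h))
    · exact Or.inl (Or.inr (Subtype.ext h))
    · exact Or.inr h

theorem HasSync.map {T : Type*} [Semigroup T] (f : T →ₙ* S) (hf : Function.Injective f)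
    (h : HasSync T) : HasSync S := by
  obtain ⟨Y, F, hY, hF, h⟩ := h
  refine ⟨f '' Y, f '' F, hY.image hf.injOn, hF.image f, ?_⟩
  rw [← Set.image_union]
  rintro _ ⟨a, ha, rfl⟩ _ ⟨b, hb, rfl⟩
  simp only [← map_mul, hf.eq_iff]
  exact (h a ha b hb).imp_right (Or.imp_right (Set.mem_image_of_mem f))

theorem HasSync.of_mulOpposite (h : HasSync Sᵐᵒᵖ) : HasSync S := by
  obtain ⟨Y, F, hY, hF, h⟩ := h
  refine ⟨MulOpposite.op ⁻¹' Y, MulOpposite.op ⁻¹' F, ?_,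
    hF.preimage MulOpposite.op_injective.injOn, fun a ha b hb => ?_⟩
  · exact hY.preimage (by simp [MulOpposite.op_surjective.range_eq])
  · rcases h (.op b) hb (.op a) ha with h | h | h
    · exact Or.inr (Or.inl (MulOpposite.op_injective h))
    · exact Or.inl (MulOpposite.op_injective h)
    · exact Or.inr (Or.inr h)

/-- An infinite set whose left multiplications all agree with that of a periodic member. -/
theorem hasSync_of_mul_eq {W : Set S} (hW : W.Infinite) {p : S} (hp : p ∈ W)
    (h : ∀ w ∈ W, ∀ w' ∈ W, w * w' = p * w')
    (hper : ∃ a d, posPow p (a + (d + 1)) = posPow p a) : HasSync S := by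
  obtain ⟨a, d, had⟩ := hper
  let L : S → S := fun y => p * y
  have hL : ∀ n y, L^[n + 1] y = posPow p n * y := by
    intro n y
    induction n with
    | zero => rfl
    | succ n ih =>
      rw [Function.iterate_succ_apply', ih, ← mul_posPow, mul_assoc]
  have hmul : ∀ i j, ∀ w ∈ W, ∀ w' ∈ W, L^[i] w * L^[j] w' = L^[i + j + 1] w' := by
    intro i j w hw w' hw'
    induction i with
    | zero =>
      rcases j with _ | j
      · exact h w hw w' hw'
      · rw [Function.iterate_succ_apply']
        change w * (p * _) = _
        rw [← mul_assoc, h w hw p hp, mul_assoc, zero_add, Function.iterate_succ_apply',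
          Function.iterate_succ_apply']
    | succ i ih =>
      rw [Function.iterate_succ_apply']
      change p * _ * _ = _
      rw [mul_assoc, ih, show i + 1 + j + 1 = (i + j + 1) + 1 by ring]
      exact (Function.iterate_succ_apply' L (i + j + 1) w').symm
  have hperL : ∀ m k y, L^[a + m + k * (d + 1) + 1] y = L^[a + m + 1] y := fun m k y => by
    rw [hL, hL, posPow_add_mul had]
  -- By `hmul`, products only push `W` further along `L`. If the images become finite, the last
  -- infinite one serves as `Y` and the later ones, finitely many by periodicity, make up `F`.
  by_cases hfin : ∃ k, (L^[k] '' W).Finite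
  · classical
    let k := Nat.find hfin
    have hk : (L^[k] '' W).Finite := Nat.find_spec hfin
    have hk0 : k ≠ 0 := by
      intro h0
      rw [h0] at hk
      simp only [Function.iterate_zero, Set.image_id] at hk
      exact hW hk
    obtain ⟨l, hl⟩ := Nat.exists_eq_succ_of_ne_zero hk0
    have hYinf : (L^[l] '' W).Infinite := Nat.find_min hfin (m := l) (by omega)
    have hfinj : ∀ j, (L^[j + k] '' W).Finite := fun j => by
      rw [Function.iterate_add, Set.image_comp]
      exact hk.image _
    refine ⟨L^[l] '' W, ⋃ j ∈ Finset.range (a + d + 1), L^[j + k] '' W, hYinf, ?_, ?_⟩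
    · exact Set.Finite.biUnion (Finset.finite_toSet _) fun j _ => hfinj j
    have hmem : ∀ n, k ≤ n → ∀ w ∈ W,
        L^[n] w ∈ ⋃ j ∈ Finset.range (a + d + 1), L^[j + k] '' W := by
      intro n
      induction n using Nat.strong_induction_on with
      | _ n ih =>
        intro hn w hw
        by_cases hlt : n < a + d + 1 + k
        · simp only [Set.mem_iUnion]
          exact ⟨n - k, Finset.mem_range.2 (by omega), w, hw, by congr 2; omega⟩
        · have := hperL (n - (d + 1) - 1 - a) 1 w
          rw [show a + (n - (d + 1) - 1 - a) + 1 * (d + 1) + 1 = n by omega] at this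
          rw [this]
          exact ih _ (by omega) (by omega) w hw
    have hform : ∀ y ∈ L^[l] '' W ∪ ⋃ j ∈ Finset.range (a + d + 1), L^[j + k] '' W,
        ∃ n w, w ∈ W ∧ l ≤ n ∧ y = L^[n] w := by
      rintro y (⟨w, hw, rfl⟩ | hy)
      · exact ⟨l, w, hw, le_rfl, rfl⟩
      · simp only [Set.mem_iUnion] at hy
        obtain ⟨j, -, w, hw, rfl⟩ := hy
        exact ⟨j + k, w, hw, by omega, rfl⟩
    intro x hx y hy
    obtain ⟨m, w, hw, hm, rfl⟩ := hform x hx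
    obtain ⟨n, w', hw', hn, rfl⟩ := hform y hy
    rw [hmul m n w hw w' hw']
    exact Or.inr (Or.inr (hmem _ (by omega) w' hw'))
  · push Not at hfin
    -- If `N` is this exponent, then `N + 1 = (a + 2) * (d + 1)` is a multiple of the period and `N
    -- > a`, so `L^[N + 1]` fixes the image of `L^[N]` and `x * y = y` there.
    refine ⟨L^[a + (a * d + 2 * d) + 1] '' W, ∅, hfin _, Set.finite_empty, ?_⟩
    rw [Set.union_empty]
    rintro _ ⟨w, hw, rfl⟩ _ ⟨w', hw', rfl⟩
    right; left
    rw [hmul _ _ w hw w' hw', ← hperL (a * d + 2 * d) (a + 2) w']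
    congr 2; ring

theorem Set.Infinite.exists_infinite_fiber {α β : Type*} {s : Set α} (hs : s.Infinite) (f : α → β)
    (hf : (f '' s).Finite) : ∃ b, {a ∈ s | f a = b}.Infinite := by
  by_contra! h
  refine hs ((hf.biUnion fun b _ => h b).subset fun a ha => ?_)
  exact Set.mem_biUnion (Set.mem_image_of_mem f ha) ⟨ha, rfl⟩

/-- Every element has finite order. -/
def IsPeriodic (S : Type*) [Semigroup S] : Prop :=
  ∀ x : S, ∃ a d, posPow x (a + (d + 1)) = posPow x a

theorem IsPeriodic.mulOpposite (h : IsPeriodic S) : IsPeriodic Sᵐᵒᵖ := by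
  intro x
  obtain ⟨a, d, had⟩ := h x.unop
  have : ∀ n, posPow x n = .op (posPow x.unop n) := by
    intro n
    induction n with
    | zero => rfl
    | succ n ih => rw [← mul_posPow, ih, posPow, ← posPow]; rfl
  exact ⟨a, d, by rw [this, this, had]⟩

/-- On an infinite fibre of `u * x ↦ u * x * u`, the product `(u * x) * (u * y)` does not depend on
`x`, so `hasSync_of_mul_eq` applies. -/
theorem hasSync_of_infinite_mul_left (hper : IsPeriodic S) (u : S) (Z : Set S)
    (h1 : ((fun x => u * x) '' Z).Infinite) (h2 : ((fun x => u * x * u) '' Z).Finite) :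
    HasSync S := by
  obtain ⟨c, hc⟩ := h1.exists_infinite_fiber (fun y => y * u) (by rwa [Set.image_image])
  obtain ⟨p, hp⟩ := hc.nonempty
  refine hasSync_of_mul_eq hc hp ?_ (hper p)
  rintro _ ⟨⟨x, hx, rfl⟩, hxc⟩ _ ⟨⟨y, hy, rfl⟩, -⟩
  have hpc := hp.2
  simp only at hxc hpc ⊢
  rw [← mul_assoc, hxc, ← mul_assoc, hpc]

theorem hasSync_of_infinite_mul_right (hper : IsPeriodic S) (u : S) (Z : Set S)
    (h1 : ((fun x => x * u) '' Z).Infinite) (h2 : ((fun x => u * x * u) '' Z).Finite) :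
    HasSync S := by
  refine HasSync.of_mulOpposite (hasSync_of_infinite_mul_left hper.mulOpposite (.op u)
    (MulOpposite.op '' Z) ?_ ?_)
  · rw [Set.image_image]
    have := h1.image (MulOpposite.op_injective.injOn)
    rwa [Set.image_image] at this
  · rw [Set.image_image]
    have := h2.image MulOpposite.op
    rw [Set.image_image] at this
    simpa only [← MulOpposite.op_mul, mul_assoc] using this

/-- If `v² S v²` is finite, the one-sided lemmas force `v S v²` and `v² S v` to be finite. Then `v S
v² S v` is finite as well, and it contains all products of elements of `v S v`. -/
theorem infinite_sandwich_sq (hper : IsPeriodic S) (hS : ¬ HasSync S) {v : S}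
    (hv : (Set.range fun x => v * x * v).Infinite) :
    (Set.range fun x => v * v * x * (v * v)).Infinite := by
  by_contra hfin
  rw [Set.not_infinite] at hfin
  by_cases h1 : (Set.range fun x => v * x * (v * v)).Infinite
  · refine hS (hasSync_of_infinite_mul_right hper (v * v) (Set.range fun x => v * x) ?_ ?_)
    · rw [← Set.range_comp]; exact h1
    · rw [← Set.range_comp]
      refine hfin.subset ?_
      rintro _ ⟨x, rfl⟩
      exact ⟨v * x, by simp only [Function.comp, mul_assoc]⟩
  by_cases h2 : (Set.range fun x => v * v * x * v).Infinite
  · refine hS (hasSync_of_infinite_mul_left hper (v * v) (Set.range fun x => x * v) ?_ ?_)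
    · rw [← Set.range_comp]; simpa only [Function.comp_def, mul_assoc] using h2
    · rw [← Set.range_comp]
      refine hfin.subset ?_
      rintro _ ⟨x, rfl⟩
      exact ⟨x * v, by simp only [Function.comp, mul_assoc]⟩
  rw [Set.not_infinite] at h1 h2
  refine hS ⟨Set.range fun x => v * x * v,
    Set.image2 (fun x y => v * x * v * (v * y * v)) Set.univ Set.univ, hv, ?_, ?_⟩
  · have : ∀ a, (Set.range fun y => v * a * (v * v) * y * v).Finite := fun a => by
      refine (h2.image fun y => v * a * y).subset ?_
      rintro _ ⟨y, rfl⟩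
      exact ⟨_, ⟨y, rfl⟩, by simp only [mul_assoc]⟩
    refine (h1.biUnion (t := fun a => Set.range fun y => a * y * v) ?_).subset ?_
    · rintro _ ⟨x, rfl⟩
      exact this x
    · rintro _ ⟨x, -, y, -, rfl⟩
      exact Set.mem_biUnion ⟨x, rfl⟩ ⟨y, by simp only [mul_assoc]⟩
  · rw [Set.union_eq_self_of_subset_right]
    · rintro _ ⟨x, rfl⟩ _ ⟨y, rfl⟩
      exact Or.inr (Or.inr ⟨x, trivial, y, trivial, rfl⟩)
    · rintro _ ⟨x, -, y, -, rfl⟩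
      exact ⟨x * v * v * y, by simp only [mul_assoc]⟩

theorem exists_idempotent_posPow (hper : IsPeriodic S) (x : S) :
    ∃ n, posPow x n * posPow x n = posPow x n := by
  obtain ⟨a, d, h⟩ := hper x
  -- This index is the exponent `(a + 1) * (d + 1)`: a multiple of the period, past the preperiod.
  refine ⟨a + (a * d + d), ?_⟩
  rw [posPow_mul_posPow]
  have := posPow_add_mul h (a + 1) (a * d + d)
  rw [← this]
  congr 1; ring

/-- Repeated squaring keeps the sandwich infinite, and a sandwich by a high power of `u` lies inside
the one by the idempotent power. -/
theorem exists_idempotent_sandwich (hper : IsPeriodic S) (hS : ¬ HasSync S) {u : S}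
    (hu : (Set.range fun x => u * x * u).Infinite) :
    ∃ e : S, e * e = e ∧ (Set.range fun x => e * x * e).Infinite := by
  obtain ⟨n, hn⟩ := exists_idempotent_posPow hper u
  refine ⟨_, hn, ?_⟩
  have h1 : ∀ k, (Set.range fun x => posPow u (2 ^ k - 1) * x * posPow u (2 ^ k - 1)).Infinite := by
    intro k
    induction k with
    | zero => exact hu
    | succ k ih =>
      have := infinite_sandwich_sq hper hS ih
      rw [posPow_mul_posPow] at this
      have h0 : 0 < 2 ^ k := by positivity
      rwa [show 2 ^ (k + 1) - 1 = 2 ^ k - 1 + (2 ^ k - 1) + 1 by rw [pow_succ]; omega]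
  refine (h1 (n + 1)).mono ?_
  rintro _ ⟨x, rfl⟩
  have h2 : n + 1 < 2 ^ (n + 1) := Nat.lt_two_pow_self
  obtain ⟨m, hm⟩ := Nat.exists_eq_add_of_lt (show n < 2 ^ (n + 1) - 1 by omega)
  refine ⟨posPow u m * x * posPow u m, ?_⟩
  have e1 := posPow_mul_posPow u n m
  have e2 := posPow_mul_posPow u m n
  simp only
  rw [hm]
  conv_rhs => rw [← e1]
  nth_rewrite 2 [e1]
  rw [show n + m + 1 = m + n + 1 by ring, ← e2]
  simp only [mul_assoc]

end Synchronizing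

/-! ### Tame semigroups. -/

section Tame

/-- All but finitely many `x` satisfy `x * x * x = x`, or have their square in a fixed finite set
and are not torsion elements of a subgroup. -/
def IsTame (S : Type*) [Semigroup S] : Prop :=
  ∃ B : Set S, B.Finite ∧ ∀ x ∉ B, x * x * x = x ∨ (x * x ∈ B ∧ ¬ IsTorsionUnit x)

variable {S : Type*} [Semigroup S]

/-- If the powers of `x` were distinct, a high power and its square would avoid `B`, and its cube
would differ from it. -/
theorem IsTame.isPeriodic (h : IsTame S) : IsPeriodic S := by
  obtain ⟨B, hB, h⟩ := h
  intro x
  by_contra! hx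
  have hinj : Function.Injective (posPow x) := by
    intro m n hmn
    by_contra hne
    wlog hlt : m < n generalizing m n
    · exact this hmn.symm (Ne.symm hne) (by omega)
    obtain ⟨d, rfl⟩ := Nat.exists_eq_add_of_lt hlt
    exact hx m d hmn.symm
  obtain ⟨N, hN⟩ := (hB.preimage (f := posPow x) hinj.injOn).bddAbove
  have hN' : ∀ n, N < n → posPow x n ∉ B := fun n hn hb => by
    have := hN hb
    omega
  rcases h _ (hN' (N + 1) (by omega)) with h1 | h1
  · rw [posPow_mul_posPow, posPow_mul_posPow] at h1
    have := hinj h1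
    omega
  · rw [posPow_mul_posPow] at h1
    exact hN' _ (by omega) h1.1

theorem IsTorsionUnit.map {T : Type*} [Semigroup T] (f : T →ₙ* S) {x : T}
    (h : IsTorsionUnit x) : IsTorsionUnit (f x) := by
  obtain ⟨n, hn⟩ := h
  exact ⟨n, by rw [← map_posPow, hn]⟩

theorem IsTame.of_injective {T : Type*} [Semigroup T] (f : T →ₙ* S) (hf : Function.Injective f)
    (h : IsTame S) : IsTame T := by
  obtain ⟨B, hB, h⟩ := h
  refine ⟨f ⁻¹' B, hB.preimage hf.injOn, fun x hx => ?_⟩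
  rcases h (f x) hx with h1 | ⟨h1, h2⟩
  · left
    apply hf
    rw [map_mul, map_mul, h1]
  · right
    rw [← map_mul] at h1
    exact ⟨h1, fun h3 => h2 (h3.map f)⟩

end Tame

/-! ### Semigroups with finite translations, via ultrafilter limits. -/

section FiniteTranslations

variable {S : Type*} [Semigroup S]

/-- The ideal generated by `F` is `F ∪ F S ∪ S F ∪ S F S`, and each piece is finite. It absorbs
every product involving the exceptional set. -/
theorem exists_finite_ideal (hl : ∀ u : S, (Set.range fun x => u * x).Finite)
    (hr : ∀ u : S, (Set.range fun x => x * u).Finite) {F : Set S} (hF : F.Finite) :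
    ∃ I : Set S, I.Finite ∧ F ⊆ I ∧ ∀ x ∈ I, ∀ s, s * x ∈ I ∧ x * s ∈ I := by
  refine ⟨(F ∪ ⋃ t ∈ F, Set.range fun x => t * x) ∪
      ((⋃ t ∈ F, Set.range fun x => x * t) ∪
        ⋃ t ∈ F, ⋃ w ∈ Set.range fun x => x * t, Set.range fun x => w * x), ?_, ?_, ?_⟩
  · exact (hF.union (hF.biUnion fun t _ => hl t)).union ((hF.biUnion fun t _ => hr t).union
      (hF.biUnion fun t _ => (hr t).biUnion fun w _ => hl w))
  · exact fun x hx => Or.inl (Or.inl hx)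
  · intro x hx s
    simp only [Set.mem_union, Set.mem_iUnion, Set.mem_range, exists_prop] at hx ⊢
    rcases hx with (hx | ⟨t, ht, y, rfl⟩) | (⟨t, ht, y, rfl⟩ | ⟨t, ht, _, ⟨z, rfl⟩, y, rfl⟩)
    · exact ⟨Or.inr (Or.inl ⟨x, hx, s, rfl⟩), Or.inl (Or.inr ⟨x, hx, s, rfl⟩)⟩
    · exact ⟨Or.inr (Or.inr ⟨t, ht, _, ⟨s, rfl⟩, y, mul_assoc _ _ _⟩),
        Or.inl (Or.inr ⟨t, ht, y * s, (mul_assoc _ _ _).symm⟩)⟩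
    · exact ⟨Or.inr (Or.inl ⟨t, ht, s * y, mul_assoc _ _ _⟩),
        Or.inr (Or.inr ⟨t, ht, _, ⟨y, rfl⟩, s, rfl⟩)⟩
    · exact ⟨Or.inr (Or.inr ⟨t, ht, _, ⟨s * z, rfl⟩, y, by simp only [mul_assoc]⟩),
        Or.inr (Or.inr ⟨t, ht, _, ⟨z, rfl⟩, y * s, by simp only [mul_assoc]⟩)⟩

theorem hasSync_of_mul_mem (hl : ∀ u : S, (Set.range fun x => u * x).Finite)
    (hr : ∀ u : S, (Set.range fun x => x * u).Finite) {Y F : Set S} (hY : Y.Infinite)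
    (hF : F.Finite) (h : ∀ a ∈ Y, ∀ b ∈ Y, a * b = a ∨ a * b = b ∨ a * b ∈ F) : HasSync S := by
  obtain ⟨I, hI, hFI, hideal⟩ := exists_finite_ideal hl hr hF
  refine ⟨Y, I, hY, hI, ?_⟩
  rintro a (ha | ha) b (hb | hb)
  · exact (h a ha b hb).imp_right (Or.imp_right fun h => hFI h)
  · exact Or.inr (Or.inr (hideal b hb a).1)
  · exact Or.inr (Or.inr (hideal a ha b).2)
  · exact Or.inr (Or.inr (hideal a ha b).2)

/-- In a tame semigroup, the condition on squares in `hasSync_of_mul_mem` can be dropped. -/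
theorem hasSync_of_pairwise (hl : ∀ u : S, (Set.range fun x => u * x).Finite)
    (hr : ∀ u : S, (Set.range fun x => x * u).Finite) (hT : IsTame S) {Y F : Set S}
    (hY : Y.Infinite) (hF : F.Finite)
    (h : ∀ a ∈ Y, ∀ b ∈ Y, a ≠ b → a * b = a ∨ a * b = b ∨ a * b ∈ F) : HasSync S := by
  obtain ⟨I, hI, hFI, hideal⟩ := exists_finite_ideal hl hr hF
  obtain ⟨B, hB, hT⟩ := hT
  by_cases hsq : ((fun x => x * x) '' Y).Finite
  · refine hasSync_of_mul_mem hl hr hY (hI.union hsq) fun a ha b hb => ?_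
    by_cases hab : a = b
    · subst hab
      exact Or.inr (Or.inr (Or.inr ⟨a, ha, rfl⟩))
    · exact (h a ha b hb hab).imp_right (Or.imp_right fun h => Or.inl (hFI h))
  -- Pass from `Y` to its squares. Removing `B` and the squares of `B` leaves only roots with `a ^ 3
  -- = a`, so the remaining squares are idempotent; the other products are controlled through `a² b²
  -- = a (a b) b`.
  · have hE : ((fun x => x * x) '' Y \ (B ∪ (fun x => x * x) '' B)).Infinite :=
      Set.Infinite.sdiff hsq (hB.union (hB.image _))
    refine hasSync_of_mul_mem hl hr hE hI ?_
    rintro _ ⟨⟨a, ha, rfl⟩, ha'⟩ _ ⟨⟨b, hb, rfl⟩, hb'⟩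
    simp only [Set.mem_union, Set.mem_image, not_or, not_exists, not_and] at ha' hb' ⊢
    have haB : a ∉ B := fun haB => ha'.2 a haB rfl
    by_cases hab : a = b
    · subst hab
      rcases hT a haB with h3 | h3
      · left
        rw [← mul_assoc, h3]
      · exact absurd h3.1 ha'.1
    · have e : a * a * (b * b) = a * (a * b) * b := by simp only [mul_assoc]
      rw [e]
      rcases h a ha b hb hab with h1 | h1 | h1
      · left
        rw [h1, mul_assoc, h1]
      · right; left
        rw [h1, h1]
      · right; right
        exact (hideal _ (hideal _ (hFI h1) a).1 b).2

/-- A sequence in the set of `p`-typical points that is typical for all its predecessors. -/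
theorem Ultrafilter.exists_seq {α : Type*} (p : Ultrafilter α) {P : α → Prop}
    {R : α → α → Prop} (hP : ∀ᶠ x in p, P x) (hR : ∀ u, ∀ᶠ y in p, R u y) :
    ∃ f : ℕ → α, (∀ n, P (f n)) ∧ ∀ m n, m < n → R (f m) (f n) :=
  exists_seq_of_forall_finset_exists P R fun s _ =>
    (hP.and ((Filter.eventually_all_finset s).2 fun u _ => hR u)).exists

theorem Ultrafilter.exists_eventually_eq {α β : Type*} (p : Ultrafilter α) (g : α → β)
    (hg : (Set.range g).Finite) : ∃ t, ∀ᶠ x in p, g x = t := by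
  obtain ⟨t, -, ht⟩ := (p.map g).eq_pure_of_finite_mem hg
    (Filter.mem_map.2 (Filter.univ_mem' fun x => ⟨x, rfl⟩))
  refine ⟨t, ?_⟩
  have : {t} ∈ p.map g := by rw [ht]; exact Ultrafilter.mem_pure.2 rfl
  exact this

theorem Ultrafilter.eventually_eq_or_ne {α β : Type*} (p : Ultrafilter α) (g : α → β) :
    (∃ t, ∀ᶠ x in p, g x = t) ∨ ∀ t, ∀ᶠ x in p, g x ≠ t := by
  by_cases h : ∃ t, ∀ᶠ x in p, g x = t
  · exact Or.inl h
  · right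
    intro t
    exact Ultrafilter.eventually_not.2 fun ht => h ⟨t, ht⟩

theorem injective_of_lt_ne {α : Type*} {f : ℕ → α} (h : ∀ m n, m < n → f n ≠ f m) :
    Function.Injective f := by
  intro m n hmn
  rcases lt_trichotomy m n with hlt | heq | hlt
  · exact absurd hmn.symm (h m n hlt)
  · exact heq
  · exact absurd hmn (h n m hlt)

/-- Let `ρ u` be the limit of `x * u`. If `ρ` is almost constant, a typical sequence has only two
values for products of distinct terms. Otherwise `ρ (f i) * ρ (f j) = f N * t * f j` for large `N`,
which lies in a finite ideal. -/
theorem hasSync_of_limit_const (hl : ∀ u : S, (Set.range fun x => u * x).Finite)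
    (hr : ∀ u : S, (Set.range fun x => x * u).Finite) (hT : IsTame S) (p : Ultrafilter S)
    (hp : ∀ a, ∀ᶠ x : S in p, x ≠ a) {φ : S → S} (hφ : ∀ u, ∀ᶠ y in p, u * y = φ u) {t : S}
    (ht : ∀ᶠ x in p, φ x = t) : HasSync S := by
  choose ρ hρ using fun u => p.exists_eventually_eq _ (hr u)
  rcases p.eventually_eq_or_ne ρ with ⟨l, hl'⟩ | hne
  · obtain ⟨f, hf, hR⟩ := p.exists_seq (ht.and hl') fun u => (hφ u).and ((hρ u).and (hp u))
    refine hasSync_of_pairwise hl hr hT (Y := Set.range f) (F := {t, l})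
      (Set.infinite_range_of_injective (injective_of_lt_ne fun m n h => (hR m n h).2.2))
      (by simp) ?_
    rintro _ ⟨i, rfl⟩ _ ⟨j, rfl⟩ hij
    right; right
    rcases lt_trichotomy i j with h | h | h
    · rw [(hR i j h).1, (hf i).1]; simp
    · exact absurd (congrArg f h) hij
    · rw [(hR j i h).2.1, (hf j).2]; simp
  · obtain ⟨f, hf, hR⟩ := p.exists_seq ht fun u => (hφ u).and ((hρ u).and (hne (ρ u)))
    obtain ⟨I, hI, htI, hideal⟩ := exists_finite_ideal hl hr (Set.finite_singleton t)
    refine hasSync_of_mul_mem hl hr (Y := Set.range (ρ ∘ f)) (F := I)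
      (Set.infinite_range_of_injective (injective_of_lt_ne fun m n h => (hR m n h).2.2)) hI ?_
    rintro _ ⟨i, rfl⟩ _ ⟨j, rfl⟩
    right; right
    simp only [Function.comp]
    have h1 : i < i + j + 1 := by omega
    rw [← (hR i _ h1).2.1, ← (hR j (i + j + 1) (by omega)).2.1, mul_assoc,
      ← mul_assoc (f i), (hR i _ h1).1, hf]
    exact (hideal _ (hideal _ (htI rfl) _).2 _).1

/-- A typical sequence satisfies `f i * f j = f i` for `i < j`. If `ρ` is almost constant, the
reversed products take one value; otherwise the elements `ρ (f i)` are distinct, and a product of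
two of them is the one of smaller index. -/
theorem hasSync_of_limit_id (hl : ∀ u : S, (Set.range fun x => u * x).Finite)
    (hr : ∀ u : S, (Set.range fun x => x * u).Finite) (hT : IsTame S) (p : Ultrafilter S)
    (hp : ∀ a, ∀ᶠ x : S in p, x ≠ a) {φ : S → S} (hφ : ∀ u, ∀ᶠ y in p, u * y = φ u)
    (hid : ∀ᶠ x in p, φ x = x) : HasSync S := by
  choose ρ hρ using fun u => p.exists_eventually_eq _ (hr u)
  rcases p.eventually_eq_or_ne ρ with ⟨l, hl'⟩ | hne
  · obtain ⟨f, hf, hR⟩ := p.exists_seq (hid.and hl') fun u => (hφ u).and ((hρ u).and (hp u))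
    refine hasSync_of_pairwise hl hr hT (Y := Set.range f) (F := {l})
      (Set.infinite_range_of_injective (injective_of_lt_ne fun m n h => (hR m n h).2.2))
      (by simp) ?_
    rintro _ ⟨i, rfl⟩ _ ⟨j, rfl⟩ hij
    rcases lt_trichotomy i j with h | h | h
    · left
      rw [(hR i j h).1, (hf i).1]
    · exact absurd (congrArg f h) hij
    · right; right
      rw [(hR j i h).2.1, (hf j).2]; rfl
  · obtain ⟨f, hf, hR⟩ := p.exists_seq hid fun u => (hφ u).and ((hρ u).and (hne (ρ u)))
    have hleft : ∀ i j, i < j → f i * f j = f i := fun i j h => by rw [(hR i j h).1, hf]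
    have hright : ∀ i j, i < j → f j * f i = ρ (f i) := fun i j h => (hR i j h).2.1
    have habs : ∀ i j, i < j → f j * ρ (f i) = ρ (f i) := fun i j h => by
      rw [← hright i (j + 1) (by omega), ← mul_assoc, hleft j _ (by omega), hright i j h,
        hright i _ (by omega)]
    refine hasSync_of_pairwise hl hr hT (Y := Set.range (ρ ∘ f)) (F := ∅)
      (Set.infinite_range_of_injective (injective_of_lt_ne fun m n h => (hR m n h).2.2))
      (by simp) ?_
    rintro _ ⟨i, rfl⟩ _ ⟨j, rfl⟩ hij
    simp only [Function.comp] at hij ⊢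
    rcases lt_trichotomy i j with h | h | h
    · left
      rw [← hright i (j + 1) (by omega), ← hright j (j + 1) (by omega), mul_assoc,
        ← mul_assoc (f i), hleft i _ (by omega), hleft i j h]
    · exact absurd (congrArg (ρ ∘ f) h) hij
    · right; left
      rw [← hright i (i + 1) (by omega), mul_assoc, habs j i h, habs j _ (by omega)]

theorem limit_mul {p : Ultrafilter S} {φ : S → S} (hφ : ∀ u, ∀ᶠ y in p, u * y = φ u) (u v : S) :
    φ (u * v) = u * φ v := by
  obtain ⟨y, h1, h2⟩ := ((hφ (u * v)).and (hφ v)).exists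
  rw [← h1, ← h2, mul_assoc]

/-- An infinite tame semigroup in which all translations have finite range. -/
theorem hasSync_of_finite_translations [Infinite S]
    (hl : ∀ u : S, (Set.range fun x => u * x).Finite)
    (hr : ∀ u : S, (Set.range fun x => x * u).Finite) (hT : IsTame S) : HasSync S := by
  let p : Ultrafilter S := Filter.hyperfilter S
  have hp : ∀ a, ∀ᶠ x : S in p, x ≠ a := fun a =>
    Filter.compl_mem_hyperfilter_of_finite (Set.finite_singleton a)
  choose φ hφ using fun u => p.exists_eventually_eq _ (hl u)
  have hiter : ∀ n u v, φ^[n] (u * v) = u * φ^[n] v := fun n u v => by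
    induction n with
    | zero => rfl
    | succ n ih => rw [Function.iterate_succ_apply', ih, limit_mul hφ, Function.iterate_succ_apply']
  have hlim : ∀ n u, ∀ᶠ x in p, u * φ^[n] x = φ^[n + 1] u := fun n u =>
    (hφ u).mono fun x hx => by rw [← hiter, hx, Function.iterate_succ_apply]
  -- Pushing `p` forward by `φ^[n]` turns the limit map into `φ^[n + 1]`. If some iterate is almost
  -- constant, the push-forward by the last non-constant one has an almost constant limit map.
  by_cases hex : ∃ n t, ∀ᶠ x in p, φ^[n] x = t
  · classical
    obtain ⟨t, ht⟩ := Nat.find_spec hex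
    have hmin : ∀ k < Nat.find hex, ∀ t, ∀ᶠ x in p, φ^[k] x ≠ t := fun k hk =>
      (p.eventually_eq_or_ne _).resolve_left (Nat.find_min hex hk)
    rcases hn : Nat.find hex with _ | k
    · rw [hn] at ht
      obtain ⟨x, h1, h2⟩ := (ht.and (hp t)).exists
      exact absurd h1 h2
    · rw [hn] at ht
      refine hasSync_of_limit_const hl hr hT (p.map φ^[k]) (hmin k (by omega)) (hlim k)
        (t := φ^[k] t) ?_
      refine Filter.eventually_map.2 (ht.mono fun x hx => ?_)
      rw [← hx, ← Function.iterate_add_apply, ← Function.iterate_add_apply, add_comm]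
  · have hne : ∀ n t, ∀ᶠ x in p, φ^[n] x ≠ t := fun n =>
      (p.eventually_eq_or_ne _).resolve_left fun h => hex ⟨n, h⟩
    -- An idempotent ultrafilter on exponents makes the limit `ψ` of the iterates of `φ` idempotent.
    obtain ⟨U, hU⟩ : ∃ U : Ultrafilter ℕ+,
        ∀ P : ℕ+ → Prop, (∀ᶠ m in U, P m) ↔ ∀ᶠ m in U, ∀ᶠ n in U, P (m + n) := by
      let _ := @Ultrafilter.addSemigroup ℕ+ _
      obtain ⟨U, hU⟩ := exists_idempotent_of_compact_t2_of_continuous_add_left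
        (M := Ultrafilter ℕ+) Ultrafilter.continuous_add_left
      refine ⟨U, fun P => ?_⟩
      rw [← Ultrafilter.eventually_add, hU]
    have hfin : ∀ u, (Set.range fun m : ℕ+ => φ^[m] u).Finite := fun u => by
      obtain ⟨y, hy⟩ := (hφ u).exists
      refine (hl u).subset ?_
      rintro _ ⟨m, rfl⟩
      -- Since `φ u = u * y`, every `φ^[m] u` equals `u * φ^[m - 1] y` and stays in the finite set
      -- `u S`.
      refine ⟨φ^[m - 1] y, ?_⟩
      simp only
      rw [← hiter, hy, ← Function.iterate_succ_apply]
      have := m.pos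
      congr 1; omega
    choose ψ hψ using fun u => U.exists_eventually_eq _ (hfin u)
    have hψψ : ∀ u, ψ (ψ u) = ψ u := fun u => by
      have h1 := (hU _).1 (hψ u)
      obtain ⟨m, h2, h3⟩ := (h1.and (hψ u)).exists
      obtain ⟨n, h4, h5⟩ := (h2.and (hψ (ψ u))).exists
      rw [← h5]
      refine Eq.trans ?_ h4
      rw [← h3, ← Function.iterate_add_apply, add_comm m n]
      rfl
    -- The shift by one is needed because the push-forward by `φ^[m - 1]` has limit map `φ^[m]`;
    -- averaging over `U` then gives `ψ`.
    let q : Ultrafilter S := U.bind fun m => p.map φ^[(m : ℕ) - 1]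
    have hq : ∀ a, ∀ᶠ x : S in q, x ≠ a := fun a =>
      Filter.eventually_bind.2 (Filter.Eventually.of_forall fun m => hne _ a)
    have hqψ : ∀ u, ∀ᶠ y in q, u * y = ψ u := fun u =>
      Filter.eventually_bind.2 ((hψ u).mono fun m hm => by
        have := hlim (m - 1) u
        rw [Nat.sub_add_cancel m.pos, hm] at this
        exact this)
    rcases q.eventually_eq_or_ne ψ with ⟨t, ht⟩ | hneψ
    · exact hasSync_of_limit_const hl hr hT q hq hqψ ht
    · refine hasSync_of_limit_id hl hr hT (q.map ψ) hneψ (φ := ψ) (fun u => ?_) ?_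
      · refine Filter.eventually_map.2 ((hqψ u).mono fun x hx => ?_)
        rw [← limit_mul hqψ, hx, hψψ]
      · exact Filter.eventually_map.2 (Filter.Eventually.of_forall hψψ)

end FiniteTranslations

/-! ### Groups consisting almost entirely of involutions. -/

section InvolutionGroups

theorem containsDirectSumZMod2_of_mul_self {G : Type*} [CommGroup G] [Infinite G]
    (h : ∀ g : G, g * g = 1) : ContainsDirectSumZMod2 G := by
  let _ : Module (ZMod 2) (Additive G) := AddCommGroup.zmodModule (n := 2) fun x => by
    rw [two_nsmul]; exact h x.toMul
  let b := Module.Basis.ofVectorSpace (ZMod 2) (Additive G)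
  have hinf : Infinite (Module.Basis.ofVectorSpaceIndex (ZMod 2) (Additive G)) := by
    by_contra hfin
    rw [not_infinite_iff_finite] at hfin
    have := Module.Finite.of_basis b
    have := Module.finite_of_finite (ZMod 2) (M := Additive G)
    exact not_finite (Additive G)
  have hli := b.linearIndependent.comp _ (Infinite.natEmbedding _).injective
  let L := Finsupp.linearCombination (ZMod 2) (b ∘ Infinite.natEmbedding _)
  exact ⟨⟨fun x => (L x.toAdd).toMul, fun x y => congrArg Additive.toMul (map_add L _ _)⟩,
    fun x y hxy => hli hxy⟩

/-- Choose `t`, then `s`, so that `t`, `s`, `t * s` and their right multiples by `g` all square to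
one. Each of the three then inverts `g` by conjugation; but `t * s`, composing two inversions, also
fixes `g`, so `g = g⁻¹`. -/
theorem mul_self_eq_one_of_finite {G : Type*} [Group G] [Infinite G]
    (h : {x : G | x * x ≠ 1}.Finite) (g : G) : g * g = 1 := by
  have hc : ∀ f : G → G, Function.Injective f → ∀ᶠ x in Filter.cofinite, f x * f x = 1 :=
    fun f hf => by
      have := h.preimage (f := f) hf.injOn
      filter_upwards [this.compl_mem_cofinite] with x hx
      by_contra h1
      exact hx h1
  obtain ⟨t, ht, htg⟩ := ((hc id Function.injective_id).and
    (hc (· * g) (mul_left_injective g))).exists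
  obtain ⟨s, hs, hsg, hts, htsg⟩ := ((hc id Function.injective_id).and
    ((hc (· * g) (mul_left_injective g)).and ((hc (t * ·) (mul_right_injective t)).and
      (hc (fun s => t * s * g) fun a b hab => by simpa using hab)))).exists
  simp only [id] at ht htg hs hsg hts htsg
  have inv : ∀ {x : G}, x * x = 1 → x⁻¹ = x := fun hx => inv_eq_of_mul_eq_one_left hx
  have e1 : t * g * t = g⁻¹ := eq_inv_of_mul_eq_one_left (by rw [← htg]; group)
  have e2 : s * g * s = g⁻¹ := eq_inv_of_mul_eq_one_left (by rw [← hsg]; group)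
  have e3 : t * s * g * (t * s) = g⁻¹ := eq_inv_of_mul_eq_one_left (by rw [← htsg]; group)
  have e4 : t * s = s * t := by
    have := inv hts
    rw [mul_inv_rev, inv ht, inv hs] at this
    exact this.symm
  have e5 : t * g⁻¹ * t = g := by
    have := congrArg (·⁻¹) e1
    simpa only [mul_inv_rev, inv ht, inv_inv, mul_assoc] using this
  have e6 : t * s * g * (t * s) = g := by
    calc
      t * s * g * (t * s) = t * (s * g * s) * t := by
          nth_rewrite 2 [e4]
          simp only [mul_assoc]
      _ = g := by rw [e2, e5]
  rw [e6] at e3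
  exact mul_eq_one_iff_eq_inv.2 e3

theorem IsTame.finite_mul_self_ne_one {G : Type*} [Group G] (h : IsTame G) :
    {x : G | x * x ≠ 1}.Finite := by
  have hper := h.isPeriodic
  obtain ⟨B, hB, h⟩ := h
  refine hB.subset fun x hx => ?_
  by_contra hxB
  rcases h x hxB with h1 | h1
  · exact hx (mul_eq_right.1 h1)
  · obtain ⟨a, d, had⟩ := hper x
    rw [← add_assoc, ← posPow_mul_posPow, mul_eq_left] at had
    exact h1.2 ⟨d, by rw [posPow, had, one_mul]⟩

theorem IsTame.containsDirectSumZMod2 {G : Type*} [Group G] [Infinite G] (h : IsTame G) :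
    ContainsDirectSumZMod2 G := by
  have h2 := mul_self_eq_one_of_finite h.finite_mul_self_ne_one
  let _ : CommGroup G :=
    { mul_comm := fun a b => by
        have hi : ∀ x : G, x⁻¹ = x := fun x => inv_eq_of_mul_eq_one_left (h2 x)
        rw [← hi (a * b), mul_inv_rev, hi, hi] }
  exact containsDirectSumZMod2_of_mul_self h2

end InvolutionGroups

/-! ### Corners `e S e`, their units, and descent along idempotents. -/

section Corners

variable {S : Type*} [Semigroup S]

theorem ContainsDirectSumZMod2.map {T : Type*} [Semigroup T] (g : T →ₙ* S)
    (hg : Function.Injective g) (h : ContainsDirectSumZMod2 T) : ContainsDirectSumZMod2 S := by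
  obtain ⟨f, hf⟩ := h
  exact ⟨g.comp f, hg.comp hf⟩

theorem exists_infinite_corner [Infinite S] (hT : IsTame S) (hS : ¬ HasSync S) :
    ∃ e : S, e * e = e ∧ (Set.range fun x => e * x * e).Infinite := by
  have hper := hT.isPeriodic
  by_contra hne
  have hfin : ∀ u : S, (Set.range fun x => u * x * u).Finite := fun u => by
    by_contra hu
    exact hne (exists_idempotent_sandwich hper hS hu)
  refine hS (hasSync_of_finite_translations (fun u => ?_) (fun u => ?_) hT)
  · by_contra hu
    exact hS (hasSync_of_infinite_mul_left hper u Set.univ (by rwa [Set.image_univ])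
      (by rw [Set.image_univ]; exact hfin u))
  · by_contra hu
    exact hS (hasSync_of_infinite_mul_right hper u Set.univ (by rwa [Set.image_univ])
      (by rw [Set.image_univ]; exact hfin u))

/-- `x` is a unit of the monoid `e S e`. -/
def IsCornerUnit (e x : S) : Prop :=
  ∃ y, e * y = y ∧ y * e = y ∧ y * x = e ∧ x * y = e

theorem mul_posPow_of_mul_eq {e x : S} (h : e * x = x) (n : ℕ) :
    e * posPow x n = posPow x n := by
  induction n with
  | zero => exact h
  | succ n ih => rw [posPow, ← mul_assoc, ih]

theorem posPow_mul_of_mul_eq {e x : S} (h : x * e = x) (n : ℕ) :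
    posPow x n * e = posPow x n := by
  induction n with
  | zero => exact h
  | succ n ih => rw [posPow, mul_assoc, h]

/-- Cancelling powers of the right inverse in a periodicity relation for `x` makes some power of `x`
equal to `e`. This is what closes the non-units under multiplication. -/
theorem isCornerUnit_of_mul_eq (hper : IsPeriodic S) {e x w : S} (hex : e * x = x)
    (hxe : x * e = x) (hew : e * w = w) (h : x * w = e) : IsCornerUnit e x := by
  have hpow : ∀ n, posPow x n * posPow w n = e := fun n => by
    induction n with
    | zero => exact h
    | succ n ih =>
      rw [posPow, ← mul_posPow w, mul_assoc, ← mul_assoc x, h, mul_posPow_of_mul_eq hew, ih]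
  obtain ⟨a, d, had⟩ := hper x
  have hd : posPow x d = e := by
    have := congrArg (· * posPow w a) had
    simp only [hpow] at this
    rwa [show a + (d + 1) = d + a + 1 by ring, ← posPow_mul_posPow, mul_assoc, hpow,
      posPow_mul_of_mul_eq hxe] at this
  have hee : posPow x (d + d + 1) = e := by
    rw [← posPow_mul_posPow, hd, ← hd, posPow_mul_of_mul_eq]
    rw [hd, hxe]
  -- Index `d - 1` would be natural, but `d` may be zero; `d + d` is one period later.
  exact ⟨posPow x (d + d), mul_posPow_of_mul_eq hex _, posPow_mul_of_mul_eq hxe _, hee,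
    by rw [mul_posPow, hee]⟩

theorem infinite_corner_units (hT : IsTame S) {e : S} (he : e * e = e)
    (hinf : {x | (e * x = x ∧ x * e = x) ∧ IsCornerUnit e x}.Infinite) :
    ContainsDirectSumZMod2 S := by
  let G : Subsemigroup S :=
    { carrier := {x | (e * x = x ∧ x * e = x) ∧ IsCornerUnit e x}
      mul_mem' := by
        rintro a b ⟨⟨ha1, ha2⟩, a', h1, h2, h3, h4⟩ ⟨⟨hb1, hb2⟩, b', k1, k2, k3, k4⟩
        refine ⟨⟨by rw [← mul_assoc, ha1], by rw [mul_assoc, hb2]⟩, b' * a', ?_, ?_, ?_, ?_⟩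
        · rw [← mul_assoc, k1]
        · rw [mul_assoc, h2]
        · rw [mul_assoc, ← mul_assoc a', h3, hb1, k3]
        · rw [mul_assoc, ← mul_assoc b, k4, h1, h4] }
  have hinv : ∀ x : G, ∃ y : G, (y : S) * x = e := by
    rintro ⟨x, ⟨hx1, hx2⟩, y, h1, h2, h3, h4⟩
    exact ⟨⟨y, ⟨h1, h2⟩, x, hx1, hx2, h4, h3⟩, h3⟩
  choose inv hinv using hinv
  let _ : Group G :=
    { (inferInstance : Semigroup G) with
      one := ⟨e, ⟨he, he⟩, e, he, he, he, he⟩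
      one_mul := fun x => Subtype.ext x.2.1.1
      mul_one := fun x => Subtype.ext x.2.1.2
      inv := inv
      inv_mul_cancel := fun x => Subtype.ext (hinv x) }
  have : Infinite G := hinf.to_subtype
  have hG : IsTame G := hT.of_injective (MulMemClass.subtype G) Subtype.val_injective
  exact ContainsDirectSumZMod2.map (MulMemClass.subtype G) Subtype.val_injective
    hG.containsDirectSumZMod2

/-- The units of the corner are finite in number, so its non-units form an infinite tame
subsemigroup. An idempotent found inside it differs from `e`, which is a unit. -/
theorem exists_smaller_corner (hT : IsTame S) (hS : ¬ HasSync S)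
    (hD : ¬ ContainsDirectSumZMod2 S) {e : S} (he : e * e = e)
    (hinf : (Set.range fun x => e * x * e).Infinite) :
    ∃ f : S, (f * f = f ∧ (Set.range fun x => f * x * f).Infinite) ∧
      f ≠ e ∧ e * f = f ∧ f * e = f := by
  let N : Subsemigroup S :=
    { carrier := {x | (e * x = x ∧ x * e = x) ∧ ¬ IsCornerUnit e x}
      mul_mem' := by
        rintro a b ⟨⟨ha1, ha2⟩, ha⟩ ⟨⟨hb1, hb2⟩, hb⟩
        refine ⟨⟨by rw [← mul_assoc, ha1], by rw [mul_assoc, hb2]⟩, ?_⟩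
        rintro ⟨y, h1, h2, h3, h4⟩
        refine ha (isCornerUnit_of_mul_eq hT.isPeriodic ha1 ha2 (w := b * y) ?_ ?_)
        · rw [← mul_assoc, hb1]
        · rw [← mul_assoc, h4] }
  have hN : (N : Set S).Infinite := by
    intro hfin
    have hG : ¬ {x | (e * x = x ∧ x * e = x) ∧ IsCornerUnit e x}.Infinite :=
      fun h => hD (infinite_corner_units hT he h)
    rw [Set.not_infinite] at hG
    refine hinf ((hfin.union hG).subset ?_)
    rintro _ ⟨x, rfl⟩
    have hx : e * (e * x * e) = e * x * e ∧ e * x * e * e = e * x * e := by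
      constructor
      · rw [← mul_assoc, ← mul_assoc, he]
      · rw [mul_assoc, he]
    by_cases hu : IsCornerUnit e (e * x * e)
    · exact Or.inr ⟨hx, hu⟩
    · exact Or.inl ⟨hx, hu⟩
  have : Infinite N := hN.to_subtype
  obtain ⟨f, hf, hfinf⟩ := exists_infinite_corner
    (hT.of_injective (MulMemClass.subtype N) Subtype.val_injective)
    fun h => hS (h.map (MulMemClass.subtype N) Subtype.val_injective)
  refine ⟨f, ⟨congrArg Subtype.val hf, ?_⟩, ?_, f.2.1.1, f.2.1.2⟩
  · refine (hfinf.image Subtype.val_injective.injOn).mono ?_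
    rintro _ ⟨_, ⟨x, rfl⟩, rfl⟩
    exact ⟨x, rfl⟩
  · intro hfe
    refine f.2.2 ?_
    rw [hfe]
    exact ⟨e, he, he, he, he⟩

theorem hasSync_of_decreasing_idempotents {f : ℕ → S} (hid : ∀ n, f n * f n = f n)
    (hne : ∀ n, f (n + 1) ≠ f n) (hl : ∀ n, f n * f (n + 1) = f (n + 1))
    (hr : ∀ n, f (n + 1) * f n = f (n + 1)) : HasSync S := by
  have hle : ∀ m k, f m * f (m + k) = f (m + k) ∧ f (m + k) * f m = f (m + k) := by
    intro m k
    induction k with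
    | zero => exact ⟨hid m, hid m⟩
    | succ k ih =>
      rw [← add_assoc]
      constructor
      · rw [← hl (m + k), ← mul_assoc, ih.1]
      · rw [← hr (m + k), mul_assoc, ih.2]
  have hinj : Function.Injective f := by
    refine injective_of_lt_ne fun m n hmn heq => ?_
    obtain ⟨k, rfl⟩ := Nat.exists_eq_add_of_lt hmn
    refine hne m ?_
    have h1 := (hle (m + 1) k).1
    rw [show m + 1 + k = m + k + 1 by ring, heq, hr] at h1
    exact h1
  refine ⟨Set.range f, ∅, Set.infinite_range_of_injective hinj, Set.finite_empty, ?_⟩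
  rw [Set.union_empty]
  rintro _ ⟨m, rfl⟩ _ ⟨n, rfl⟩
  rcases le_total m n with h | h
  · obtain ⟨k, rfl⟩ := Nat.exists_eq_add_of_le h
    exact Or.inr (Or.inl (hle m k).1)
  · obtain ⟨k, rfl⟩ := Nat.exists_eq_add_of_le h
    exact Or.inl (hle n k).2

theorem IsTame.hasSync_or_containsDirectSumZMod2 [Infinite S] (hT : IsTame S) :
    HasSync S ∨ ContainsDirectSumZMod2 S := by
  by_contra! h
  obtain ⟨hS, hD⟩ := h
  let C : Type _ := {e : S // e * e = e ∧ (Set.range fun x => e * x * e).Infinite}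
  have hstep : ∀ e : C, ∃ f : C, f.1 ≠ e.1 ∧ e.1 * f.1 = f.1 ∧ f.1 * e.1 = f.1 := fun e => by
    obtain ⟨f, hf, hfe⟩ := exists_smaller_corner hT hS hD e.2.1 e.2.2
    exact ⟨⟨f, hf⟩, hfe⟩
  choose next hnext using hstep
  obtain ⟨e, he⟩ := exists_infinite_corner hT hS
  let g : ℕ → C := fun n => next^[n] ⟨e, he⟩
  have hg : ∀ n, g (n + 1) = next (g n) := fun n => Function.iterate_succ_apply' _ _ _
  refine hS (hasSync_of_decreasing_idempotents (f := fun n => (g n).1) (fun n => (g n).2.1)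
    (fun n => ?_) (fun n => ?_) fun n => ?_)
  all_goals simp only [hg]
  · exact (hnext (g n)).1
  · exact (hnext (g n)).2.1
  · exact (hnext (g n)).2.2

/-- There is a two-colouring for which almost-monochromatic subsemigroups are tame. -/
theorem exists_coloring_isTame (S : Type*) [Semigroup S] :
    ∃ c : S → Bool, ∀ T : Subsemigroup S, AlmostMonochromatic c (T : Set S) → IsTame T := by
  obtain ⟨c, hc⟩ := exists_bool_coloring (invOrSq (S := S)) fun x n => invOrSq_periodic
  refine ⟨c, fun T ⟨k, hk⟩ => ?_⟩
  -- Including the image under `invOrSq` excludes torsion units whose inverse has the wrong colour.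
  refine ⟨Subtype.val ⁻¹' ({a ∈ (T : Set S) | c a ≠ k} ∪ invOrSq '' {a ∈ (T : Set S) | c a ≠ k}),
    (hk.union (hk.image _)).preimage Subtype.val_injective.injOn, ?_⟩
  rintro ⟨x, hx⟩ hxB
  rw [Set.mem_preimage, Set.mem_union, not_or] at hxB
  have hxk : c x = k := by
    by_contra h
    exact hxB.1 ⟨hx, h⟩
  by_cases hfix : invOrSq x = x
  · exact Or.inl (Subtype.ext (mul_mul_self_of_invOrSq_eq hfix))
  · right
    have hmem : invOrSq x ∈ {a ∈ (T : Set S) | c a ≠ k} :=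
      ⟨invOrSq_mem T hx, fun h => hc x hfix (h.trans hxk.symm)⟩
    have htor : ¬ IsTorsionUnit x := fun h => hxB.2 ⟨_, hmem, h.invOrSq_invOrSq⟩
    rw [invOrSq_of_not_isTorsionUnit htor] at hmem
    exact ⟨Or.inl hmem, fun h => htor (h.map (MulMemClass.subtype T))⟩

end Corners

/-! ### Monochromatic subsemigroups from either structure. -/

section Ramsey

variable {S : Type*} [Semigroup S]

theorem FinitelySynchronizing.exists_almostMonochromatic {T : Subsemigroup S}
    (hT : (T : Set S).Infinite) (h : FinitelySynchronizing T) (n : ℕ) :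
    HasAlmostMonoSubsemigroups S n := by
  obtain ⟨F, hF, h⟩ := h
  intro c
  obtain ⟨k, hk⟩ := hT.exists_infinite_fiber c (Set.toFinite _)
  have hFfin : (Subtype.val '' F : Set S).Finite := hF.image _
  refine ⟨⟨{a ∈ (T : Set S) | c a = k} ∪ Subtype.val '' F, fun {a b} ha hb => ?_⟩,
    hk.mono Set.subset_union_left, k, hFfin.subset ?_⟩
  · have hmem : ∀ x ∈ {a ∈ (T : Set S) | c a = k} ∪ Subtype.val '' F, x ∈ T := by
      rintro x (hx | ⟨y, -, rfl⟩)
      · exact hx.1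
      · exact y.2
    rcases h ⟨a, hmem a ha⟩ ⟨b, hmem b hb⟩ with (h | h) | h
    · have := congrArg Subtype.val h
      simp only [MulMemClass.mk_mul_mk] at this
      rwa [this]
    · have := congrArg Subtype.val h
      simp only [MulMemClass.mk_mul_mk] at this
      rwa [this]
    · exact Or.inr ⟨_, h, rfl⟩
  · rintro a ⟨ha | ha, hne⟩
    · exact absurd ha.2 hne
    · exact ha

/-- The offset `N` and the vanishing below it let the induction pass to tails; finite sums of
distinct basis vectors can then be coloured while leaving out zero. -/
theorem ne_zero_of_mem_FS_single {a : Stream' (ℕ →₀ ZMod 2)} {m : ℕ →₀ ZMod 2}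
    (hm : m ∈ Hindman.FS a) : ∀ N, (∀ i, a.get i = Finsupp.single (N + i) 1) →
      m ≠ 0 ∧ ∀ j < N, m j = 0 := by
  induction hm with
  | head' a =>
    intro N h
    have h0 : a.head = Finsupp.single N 1 := h 0
    rw [h0]
    refine ⟨by simp, fun j hj => ?_⟩
    rw [Finsupp.single_apply, if_neg (by omega)]
  | tail' a m hm ih =>
    intro N h
    obtain ⟨h1, h2⟩ := ih (N + 1) fun i => by
      rw [Stream'.get_tail, h, show N + (i + 1) = N + 1 + i by ring]
    exact ⟨h1, fun j hj => h2 j (by omega)⟩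
  | cons' a m hm ih =>
    intro N h
    have h0 : a.head = Finsupp.single N 1 := h 0
    obtain ⟨h1, h2⟩ := ih (N + 1) fun i => by
      rw [Stream'.get_tail, h, show N + (i + 1) = N + 1 + i by ring]
    rw [h0]
    constructor
    · intro hz
      have := DFunLike.congr_fun hz N
      rw [Finsupp.add_apply, h2 N (by omega)] at this
      simp at this
    · intro j hj
      rw [Finsupp.add_apply, h2 j (by omega), Finsupp.single_apply, if_neg (by omega), add_zero]

theorem ContainsDirectSumZMod2.exists_almostMonochromatic (h : ContainsDirectSumZMod2 S) (n : ℕ) :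
    HasAlmostMonoSubsemigroups S n := by
  obtain ⟨f, hf⟩ := h
  intro c
  obtain ⟨_, ⟨k, rfl⟩, b, hb⟩ := Hindman.FS_partition_regular
    (fun i => Finsupp.single i 1 : Stream' (ℕ →₀ ZMod 2))
    (Set.range fun k : Fin n => {x | x ≠ 0 ∧ c (f (Multiplicative.ofAdd x)) = k})
    (Set.finite_range _) (fun m hm => Set.mem_sUnion.2 ⟨_, ⟨_, rfl⟩,
      (ne_zero_of_mem_FS_single hm 0 fun i => by rw [zero_add]; rfl).1, rfl⟩)
  -- Over `ZMod 2` a nonzero combination is a finite sum of distinct terms of `b`. It is therefore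
  -- nonzero and of colour `k`, which gives injectivity and monochromaticity away from the identity
  -- together.
  let L := Finsupp.linearCombination (ZMod 2) b.get
  have hL : ∀ x ≠ 0, L x ≠ 0 ∧ c (f (Multiplicative.ofAdd (L x))) = k := fun x hx => by
    refine hb ?_
    have : L x = ∑ i ∈ x.support, b.get i := by
      rw [Finsupp.linearCombination_apply, Finsupp.sum]
      refine Finset.sum_congr rfl fun i hi => ?_
      have h1 : x i = 1 := Fin.eq_one_of_ne_zero _ (Finsupp.mem_support_iff.1 hi)
      rw [h1, one_smul]
    rw [this]
    exact Hindman.FS.finsetSum b x.support (Finsupp.support_nonempty_iff.2 hx)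
  have hLinj : Function.Injective L := by
    rw [injective_iff_map_eq_zero]
    intro x hx
    by_contra hne
    exact (hL x hne).1 hx
  let g : Multiplicative (ℕ →₀ ZMod 2) →ₙ* S :=
    f.comp (AddMonoidHom.toMultiplicative L.toAddMonoidHom : _ →ₙ* _)
  have hg : Function.Injective g := hf.comp hLinj
  refine ⟨g.srange, ?_, k, (Set.finite_singleton (g 1)).subset ?_⟩
  · rw [MulHom.coe_srange]
    exact Set.infinite_range_of_injective hg
  · rintro _ ⟨⟨x, rfl⟩, hx⟩
    by_contra hne
    refine hx (hL x.toAdd fun h0 => hne ?_).2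
    rw [Set.mem_singleton_iff, show x = 1 from h0]

end Ramsey

theorem theorem3p4 {S : Type*} [Semigroup S] :
    List.TFAE [
      ∀ n : ℕ, HasAlmostMonoSubsemigroups S n,
      HasAlmostMonoSubsemigroups S 2,
      (∃ T : Subsemigroup S, (T : Set S).Infinite ∧ FinitelySynchronizing T) ∨
        ContainsDirectSumZMod2 S] := by
  tfae_have 1 → 2 := fun h => h 2
  tfae_have 2 → 3 := by
    intro h
    obtain ⟨c, hc⟩ := exists_coloring_isTame S
    obtain ⟨T, hTinf, k, hk⟩ := h fun x => finTwoEquiv.symm (c x)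
    have hT : IsTame T := hc T ⟨finTwoEquiv k, by
      simpa only [ne_eq, Equiv.symm_apply_eq] using hk⟩
    have : Infinite T := hTinf.to_subtype
    exact hT.hasSync_or_containsDirectSumZMod2.imp
      (fun h => (h.map (MulMemClass.subtype T) Subtype.val_injective).exists_subsemigroup)
      fun h => h.map (MulMemClass.subtype T) Subtype.val_injective
  tfae_have 3 → 1 := by
    rintro (⟨T, hT, h⟩ | h) n
    · exact h.exists_almostMonochromatic hT n
    · exact h.exists_almostMonochromatic n
  tfae_finish
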